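/- **Setting (combinatorial multi-armed bandit with probabilistically triggered arms).** There are $m$ arms and a finite set $\mathcal S$ of actions. In every epoch $t=1,2,\dots$ the learner plays an action $S_t\in\mathcal S$. The state vector $\boldsymbol X^{(t)}=(X^{(t)}_1,\dots,X^{(t)}_m)\in\{0,1\}^m$ is drawn from a fixed (unknown) joint distribution $D$, independently of the past and of $S_t$. Then a random set $\tau_t\subseteq\{1,\dots,m\}$ of triggered arms is drawn from $D^{\mathrm{trig}}(S_t,\boldsymbol X^{(t)})$, and the learner observes $X_i^{(t)}$ for $i\in\tau_t$. Let $\mu_i=\mathbb E_{\boldsymbol X\sim D}[X_i]$. Assume that for some $p^*>0$ all arm triggering probabilities are at least $p^*$, i.e. $\Pr(i\in\tau)\ge p^*$ for every action $S\in\mathcal S$ and every arm $i$, where $\boldsymbol X\sim D$ and $\tau\sim D^{\mathrm{trig}}(S,\boldsymbol X)$. Assume also that, for every action $S$ and every arm $i$, the event $\{i\in\tau\}$ is independent of the state $X_i$ of that same arm (it may depend on the states of the other arms), so that the observed states of arm $i$ have mean $\mu_i$. **Combinatorial Thompson Sampling (CTS).** Start with counters $s_i=f_i=0$ for all arms. In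 each epoch $t\ge 1$, draw independent samples $\nu_i^t\sim\mathrm{Beta}(s_i+1,f_i+1)$, $i=1,\dots,m$. Feed $\boldsymbol\nu^t=(\nu^t_1,\dots,\nu^t_m)$ to a (possibly randomized) approximation algorithm, which returns $S_t$. Play $S_t$, and for each $i\in\tau_t$ increase $s_i$ by one if $X_i^{(t)}=1$ and $f_i$ by one if $X_i^{(t)}=0$. Let $\Delta_t^{\boldsymbol\nu}=\max_{1\le i\le m}|\nu_i^t-\mu_i|$. **Theorem.** When CTS is run, for any $\delta>0$ and $\eta\in(0,1)$, we have for all integers $t\ge t':=4c^2/e^2$, where $c=1/(p^*(1-\eta))^2$, $$\Pr\big(\Delta_{t+1}^{\boldsymbol\nu}\ge\delta\big)\;\le\;(3+e^{2\delta})\,m\left(\frac{1}{t^2\,(1-e^{-\delta^2/2})}+e^{-\delta^2\eta p^* t/2}\right).$$ -/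

import Mathlib

open MeasureTheory ProbabilityTheory

namespace CMAB

/-- Everything that happens in one epoch with `m` arms and action set `A`, in the order of
occurrence: the Thompson samples `ν`, the action `S`, the state vector `X`, and the set `τ` of
triggered arms. -/
abbrev Epoch (m : ℕ) (A : Type*) := (Fin m → ℝ) × A × (Fin m → ℝ) × Set (Fin m)

/-- The success and failure counters `(s, f)` of all arms. -/
abbrev Counters (m : ℕ) := (Fin m → ℕ) × (Fin m → ℕ)

/-! ### The bandit problem -/

/-- The expected state `μ_i` of arm `i` under the joint state distribution `D`. -/
noncomputable def mean {m : ℕ} (D : Measure (Fin m → ℝ)) (i : Fin m) : ℝ := ∫ x, x i ∂D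

/-- The joint law of `(X, τ)` when action `S` is played: `X ∼ D` (whatever the action is) and then
`τ ∼ trig (S, X)`. -/
noncomputable def envKernel {m : ℕ} {A : Type*} [MeasurableSpace A] (D : Measure (Fin m → ℝ))
    (trig : Kernel (A × (Fin m → ℝ)) (Set (Fin m))) :
    Kernel A ((Fin m → ℝ) × Set (Fin m)) :=
  (Kernel.const A D).compProd trig

/-- The arm triggering probability (ATP) of arm `i` under action `S`: the probability of
`i ∈ τ` when `X ∼ D` and `τ ∼ trig (S, X)`. -/
noncomputable def atp {m : ℕ} {A : Type*} [MeasurableSpace A] (D : Measure (Fin m → ℝ))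
    (trig : Kernel (A × (Fin m → ℝ)) (Set (Fin m))) (S : A) (i : Fin m) : ℝ :=
  (envKernel D trig S).real {z | i ∈ z.2}

/-! ### Combinatorial Thompson sampling -/

open Classical in
/-- The change of the counters in one epoch: for every triggered arm `i`, the success counter is
incremented if `X_i = 1`, and the failure counter is incremented otherwise. -/
noncomputable def increment {m : ℕ} {A : Type*} (e : Epoch m A) : Counters m :=
  (fun i => if i ∈ e.2.2.2 ∧ e.2.2.1 i = 1 then 1 else 0,
   fun i => if i ∈ e.2.2.2 ∧ e.2.2.1 i ≠ 1 then 1 else 0)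

/-- The counters after a history of `n + 1` epochs; they are all zero initially. -/
noncomputable def counters {m : ℕ} {A : Type*} (n : ℕ)
    (h : (j : Finset.Iic n) → Epoch m A) : Counters m :=
  ∑ j, increment (h j)

/-- Given the counters, the samples `ν_i` are drawn independently,
`ν_i ∼ Beta(s_i + 1, f_i + 1)`. -/
noncomputable def sampleKernel (m : ℕ) : Kernel (Counters m) (Fin m → ℝ) :=
  Kernel.ofFunOfCountable fun c =>
    Measure.pi fun i => betaMeasure ((c.1 i : ℝ) + 1) ((c.2 i : ℝ) + 1)

/-- One epoch of CTS, started with given counters: the samples `ν` are drawn, the (randomized)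
approximation algorithm `oracle` returns an action `S` on input `ν`, the states `X ∼ D` are drawn
independently of `ν` and `S`, and the arms in `τ ∼ trig (S, X)` are triggered. -/
noncomputable def epochKernel {m : ℕ} {A : Type*} [MeasurableSpace A] (D : Measure (Fin m → ℝ))
    (trig : Kernel (A × (Fin m → ℝ)) (Set (Fin m))) (oracle : Kernel (Fin m → ℝ) A) :
    Kernel (Counters m) (Epoch m A) :=
  (sampleKernel m).compProd
    (Kernel.prodMkLeft (Counters m)
      (oracle.compProd (Kernel.prodMkLeft (Fin m → ℝ) (envKernel D trig))))

instance {m : ℕ} : IsMarkovKernel (sampleKernel m) := by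
  refine ⟨fun c => ?_⟩
  have (i : Fin m) : IsProbabilityMeasure (betaMeasure ((c.1 i : ℝ) + 1) ((c.2 i : ℝ) + 1)) :=
    isProbabilityMeasureBeta (by positivity) (by positivity)
  change IsProbabilityMeasure
    (Measure.pi fun i => betaMeasure ((c.1 i : ℝ) + 1) ((c.2 i : ℝ) + 1))
  infer_instance

instance {m : ℕ} {A : Type*} [MeasurableSpace A] (D : Measure (Fin m → ℝ))
    [IsProbabilityMeasure D] (trig : Kernel (A × (Fin m → ℝ)) (Set (Fin m)))
    [IsMarkovKernel trig] : IsMarkovKernel (envKernel D trig) := by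
  unfold envKernel; infer_instance

instance {m : ℕ} {A : Type*} [MeasurableSpace A] (D : Measure (Fin m → ℝ))
    [IsProbabilityMeasure D] (trig : Kernel (A × (Fin m → ℝ)) (Set (Fin m)))
    [IsMarkovKernel trig] (oracle : Kernel (Fin m → ℝ) A) [IsMarkovKernel oracle] :
    IsMarkovKernel (epochKernel D trig oracle) := by
  unfold epochKernel; infer_instance

lemma measurable_increment {m : ℕ} {A : Type*} [MeasurableSpace A] :
    Measurable (increment : Epoch m A → Counters m) := by
  have h1 (i : Fin m) : MeasurableSet {e : Epoch m A | i ∈ e.2.2.2} :=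
    measurableSet_setOfPred.2 <|
      (measurable_set_mem i).comp (measurable_snd.comp (measurable_snd.comp measurable_snd))
  have h2 (i : Fin m) : MeasurableSet {e : Epoch m A | e.2.2.1 i = 1} :=
    measurableSet_eq_fun (by fun_prop) measurable_const
  refine Measurable.prodMk (measurable_pi_lambda _ fun i => ?_) (measurable_pi_lambda _ fun i => ?_)
  · exact Measurable.ite ((h1 i).inter (h2 i)) measurable_const measurable_const
  · exact Measurable.ite ((h1 i).inter (h2 i).compl) measurable_const measurable_const

lemma measurable_counters {m : ℕ} {A : Type*} [MeasurableSpace A] (n : ℕ) :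
    Measurable (counters n : ((j : Finset.Iic n) → Epoch m A) → Counters m) := by
  unfold counters
  exact Finset.measurable_fun_sum _ fun j _ => measurable_increment.comp (measurable_pi_apply j)

/-- The law of the whole run of CTS. Coordinate `n` of a trajectory is epoch `n + 1`: the first
epoch starts with all counters equal to zero, and each later one with the counters that result
from the epochs before it. -/
noncomputable def ctsLaw {m : ℕ} {A : Type*} [MeasurableSpace A] (D : Measure (Fin m → ℝ))
    [IsProbabilityMeasure D] (trig : Kernel (A × (Fin m → ℝ)) (Set (Fin m)))
    [IsMarkovKernel trig] (oracle : Kernel (Fin m → ℝ) A) [IsMarkovKernel oracle] :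
    Measure (ℕ → Epoch m A) :=
  Kernel.trajMeasure (X := fun _ => Epoch m A) (epochKernel D trig oracle 0)
    fun n => (epochKernel D trig oracle).comap (counters n) (measurable_counters n)

/-- `Δ_t^ν = max_i |ν_i^t - μ_i|` on a trajectory, for `t ≥ 1` (coordinate `t - 1` of the
trajectory is epoch `t`). -/
noncomputable def sampleDeviation {m : ℕ} {A : Type*} (D : Measure (Fin m → ℝ)) (t : ℕ)
    (ω : ℕ → Epoch m A) : ℝ :=
  ⨆ i : Fin m, |(ω (t - 1)).1 i - mean D i|

end CMAB

namespace CMAB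

/-! ### Hoeffding's lemma for a Bernoulli variable -/

/-! Fix an arm with mean `q`, and let `s`, `f` be its counters after `t` epochs. A deviation of the
next sample by `δ` needs one of two events. Either `s + f < η p* t`. Each epoch triggers the arm
with conditional probability at least `p*`, whatever the history, so Chernoff gives `exp (-2t/c)`,
which is at most `1/t²` once `t ≥ t'` (`measure_count_lt_le`, `log_le_div_of_sq_le`). Or `s + f ≥ η
p* t` and the posterior sample is off. By beta–binomial duality (`betaMeasure_Ici_eq`) and Chernoff,
each posterior tail is at most `exp (-δ² (s + f)) * M`, with `M` exponential in `(s, f)`.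
Hoeffding's lemma makes `M` a supermartingale under any adaptive play, so `E M ≤ 1` and no union
over the values of `s + f` is needed (`measure_sample_mem_le`). The total per arm, `1/t² + 2 exp
(-δ² η p* t)`, is stronger than required; a union bound over arms finishes. -/

lemma bernoulli_mgf_le {p : ℝ} (hp0 : 0 ≤ p) (hp1 : p ≤ 1) (l : ℝ) :
    1 - p + p * Real.exp l ≤ Real.exp (l * p + l ^ 2 / 8) := by
  -- The Bernoulli law as a measure on `ℝ`, so that Hoeffding's lemma for variables in `[0, 1]`
  -- applies.
  set μ : Measure ℝ := ENNReal.ofReal (1 - p) • Measure.dirac 0 + ENNReal.ofReal p • Measure.dirac 1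
    with hμ
  have : IsProbabilityMeasure μ := ⟨by
    simp [hμ, ← ENNReal.ofReal_add (sub_nonneg.2 hp1) hp0]⟩
  have hint (g : ℝ → ℝ) : ∫ x, g x ∂μ = (1 - p) * g 0 + p * g 1 := by
    rw [hμ, integral_add_measure, integral_smul_measure, integral_smul_measure]
    · simp [ENNReal.toReal_ofReal hp0, ENNReal.toReal_ofReal (sub_nonneg.2 hp1)]
    · exact (integrable_dirac (by simp)).smul_measure (by simp)
    · exact (integrable_dirac (by simp)).smul_measure (by simp)
  have hb : ∀ᵐ x ∂μ, (fun x : ℝ => x) x ∈ Set.Icc (0 : ℝ) 1 := by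
    rw [hμ, ae_add_measure_iff]
    constructor <;> refine Measure.ae_smul_measure ?_ _ <;> rw [ae_dirac_eq] <;> simp
  have h := (hasSubgaussianMGF_of_mem_Icc (μ := μ) (X := fun x => x) (by fun_prop) hb).mgf_le l
  rw [mgf, hint, hint] at h
  simp only [mul_zero, mul_one, zero_add, zero_sub, sub_zero, nnnorm_one, NNReal.coe_pow,
    NNReal.coe_div, NNReal.coe_one, NNReal.coe_ofNat] at h
  calc 1 - p + p * Real.exp l
      = Real.exp (l * p) * ((1 - p) * Real.exp (l * -p) + p * Real.exp (l * (1 - p))) := by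
        rw [mul_add, mul_left_comm, ← Real.exp_add, mul_left_comm, ← Real.exp_add]
        ring_nf
        simp
        ring
    _ ≤ Real.exp (l * p) * Real.exp ((1 / 2) ^ 2 * l ^ 2 / 2) := by gcongr
    _ = _ := by rw [← Real.exp_add]; ring_nf

/-! ### Tails of beta distributions with integer parameters -/

open Polynomial in
-- The derivatives telescope. Up to sign, the result is the density of `Beta(s + 1, n - s + 1)` when
-- `s ≤ n`.
lemma derivative_sum_bernsteinPolynomial (n s : ℕ) :
    derivative (∑ j ∈ Finset.range (s + 1), bernsteinPolynomial ℝ (n + 1) j) =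
      -((n : ℝ[X]) + 1) * bernsteinPolynomial ℝ n s := by
  induction s with
  | zero => simp [bernsteinPolynomial.derivative_zero]
  | succ s ih =>
    rw [Finset.sum_range_succ, derivative_add, ih, bernsteinPolynomial.derivative_succ]
    push_cast
    ring

/-- Chernoff's bound for the lower tail of a binomial distribution. -/
lemma sum_bernsteinPolynomial_eval_le {x l : ℝ} (hx0 : 0 ≤ x) (hx1 : x ≤ 1) (hl : 0 ≤ l)
    {n s : ℕ} (hs : s ≤ n) :
    (∑ j ∈ Finset.range (s + 1), bernsteinPolynomial ℝ n j).eval x ≤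
      Real.exp (l * s - l * n * x + l ^ 2 * n / 8) := by
  have hx : 0 ≤ 1 - x := sub_nonneg.2 hx1
  calc (∑ j ∈ Finset.range (s + 1), bernsteinPolynomial ℝ n j).eval x
      = ∑ j ∈ Finset.range (s + 1), (n.choose j : ℝ) * x ^ j * (1 - x) ^ (n - j) := by
        simp [Polynomial.eval_finsetSum, bernsteinPolynomial]
    -- Each term is weighted by `exp (l * (s - j)) ≥ 1`; the sum then extends to all `j` and the
    -- binomial theorem applies.
    _ ≤ ∑ j ∈ Finset.range (s + 1), Real.exp (l * s) *
          ((x * Real.exp (-l)) ^ j * (1 - x) ^ (n - j) * (n.choose j : ℝ)) := by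
        refine Finset.sum_le_sum fun j hj => ?_
        have hj : (j : ℝ) ≤ s := by exact_mod_cast Finset.mem_range_succ_iff.1 hj
        have h1 : 1 ≤ Real.exp (l * s) * Real.exp (-l) ^ j := by
          rw [← Real.exp_nat_mul, ← Real.exp_add, Real.one_le_exp_iff]
          nlinarith
        have h2 : 0 ≤ (n.choose j : ℝ) * x ^ j * (1 - x) ^ (n - j) := by positivity
        calc _ ≤ ((n.choose j : ℝ) * x ^ j * (1 - x) ^ (n - j)) *
              (Real.exp (l * s) * Real.exp (-l) ^ j) := le_mul_of_one_le_right h2 h1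
          _ = _ := by ring
    _ ≤ ∑ j ∈ Finset.range (n + 1), Real.exp (l * s) *
          ((x * Real.exp (-l)) ^ j * (1 - x) ^ (n - j) * (n.choose j : ℝ)) := by
        refine Finset.sum_le_sum_of_subset_of_nonneg
          (Finset.range_subset_range.2 (by omega)) fun j _ _ => by positivity
    _ = Real.exp (l * s) * (1 - x + x * Real.exp (-l)) ^ n := by
        rw [← Finset.mul_sum, ← add_pow, add_comm]
    _ ≤ Real.exp (l * s) * Real.exp (-l * x + (-l) ^ 2 / 8) ^ n := by
        gcongr
        exact bernoulli_mgf_le hx0 hx1 _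
    _ = _ := by
        rw [← Real.exp_nat_mul, ← Real.exp_add]
        ring_nf

lemma one_div_beta_natCast (s f : ℕ) :
    1 / beta ((s : ℝ) + 1) ((f : ℝ) + 1) = ((s + f : ℕ) + 1 : ℝ) * ((s + f).choose s : ℝ) := by
  have h : ((s + f).choose s : ℝ) * s.factorial * f.factorial = (s + f).factorial := by
    rw [Nat.choose_symm_add]
    exact_mod_cast Nat.add_choose_mul_factorial_mul_factorial s f
  have e : (s : ℝ) + 1 + (f + 1) = ((s + f + 1 : ℕ) : ℝ) + 1 := by push_cast; ring
  rw [beta, e, Real.Gamma_nat_eq_factorial, Real.Gamma_nat_eq_factorial,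
    Real.Gamma_nat_eq_factorial, Nat.factorial_succ, one_div_div,
    div_eq_iff (by positivity)]
  push_cast at h ⊢
  rw [← h]
  ring

lemma betaPDFReal_natCast_eq {s f : ℕ} {y : ℝ} (hy0 : 0 < y) (hy1 : y < 1) :
    betaPDFReal ((s : ℝ) + 1) ((f : ℝ) + 1) y =
      ((s + f : ℕ) + 1 : ℝ) * (bernsteinPolynomial ℝ (s + f) s).eval y := by
  rw [betaPDFReal, if_pos ⟨hy0, hy1⟩, one_div_beta_natCast]
  simp [bernsteinPolynomial]
  ring

/-- Beta–binomial duality: `-G` is an antiderivative of the density, and `G` vanishes at `1` because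
`j ≤ s < s + f + 1`. -/
lemma betaMeasure_Ici_eq {s f : ℕ} {x : ℝ} (hx0 : 0 ≤ x) (hx1 : x ≤ 1) :
    betaMeasure ((s : ℝ) + 1) ((f : ℝ) + 1) (Set.Ici x) =
      ENNReal.ofReal
        ((∑ j ∈ Finset.range (s + 1), bernsteinPolynomial ℝ (s + f + 1) j).eval x) := by
  set G : Polynomial ℝ := ∑ j ∈ Finset.range (s + 1), bernsteinPolynomial ℝ (s + f + 1) j with hG
  set g : ℝ → ℝ := fun y => ((s + f : ℕ) + 1 : ℝ) * (bernsteinPolynomial ℝ (s + f) s).eval y with hg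
  have hg0 : ∀ y ∈ Set.Ioo x 1, 0 ≤ g y := fun y hy => by
    have : 0 ≤ y := hx0.trans hy.1.le
    have : 0 ≤ 1 - y := sub_nonneg.2 hy.2.le
    simp only [hg, bernsteinPolynomial, Polynomial.eval_mul, Polynomial.eval_natCast,
      Polynomial.eval_pow, Polynomial.eval_X, Polynomial.eval_sub, Polynomial.eval_one]
    positivity
  have hgc : Continuous g := by fun_prop
  have h1 : G.eval 1 = 0 := by
    rw [hG, Polynomial.eval_finsetSum]
    refine Finset.sum_eq_zero fun j hj => ?_
    rw [bernsteinPolynomial.eval_at_1, if_neg]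
    have := Finset.mem_range.1 hj
    omega
  have hint : ∫ y in x..1, g y = G.eval x := by
    have := intervalIntegral.integral_eq_sub_of_hasDerivAt (a := x) (b := 1)
      (f := fun y => -G.eval y) (f' := g) (fun y _ => by
        have h := (G.hasDerivAt y).fun_neg
        rw [show G.derivative = _ from derivative_sum_bernsteinPolynomial _ _] at h
        convert h using 1
        simp [hg]
        ring) (hgc.intervalIntegrable _ _)
    rw [this, h1]; ring
  -- The two sides may differ at the endpoint `x`, which is a null set.
  have hind : ∀ᵐ y : ℝ, y ∈ Set.Ici x →
      betaPDF ((s : ℝ) + 1) ((f : ℝ) + 1) y =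
        (Set.Ioo x 1).indicator (fun y => ENNReal.ofReal (g y)) y := by
    filter_upwards [Measure.ae_ne volume x] with y hy hxy
    have hxy : x < y := lt_of_le_of_ne hxy (Ne.symm hy)
    by_cases h : y < 1
    · rw [Set.indicator_of_mem (s := Set.Ioo x 1) ⟨hxy, h⟩, betaPDF,
        betaPDFReal_natCast_eq (hx0.trans_lt hxy) h]
    · rw [betaPDF_eq_zero_of_one_le (not_lt.1 h), Set.indicator_of_notMem (fun h' => h h'.2)]
  rw [betaMeasure, withDensity_apply _ measurableSet_Ici,
    setLIntegral_congr_fun_ae measurableSet_Ici hind,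
    lintegral_indicator measurableSet_Ioo, Measure.restrict_restrict measurableSet_Ioo,
    Set.inter_eq_left.2 (fun y hy => hy.1.le), ← hint, intervalIntegral.integral_of_le hx1,
    integral_Ioc_eq_integral_Ioo, ofReal_integral_eq_lintegral_ofReal]
  · exact (hgc.integrableOn_Icc (a := x) (b := 1)).mono_set Set.Ioo_subset_Icc_self
  · exact (ae_restrict_iff' measurableSet_Ioo).2 (Filter.Eventually.of_forall hg0)

lemma betaMeasure_Ici_le {s f : ℕ} {x l : ℝ} (hx0 : 0 ≤ x) (hl : 0 ≤ l) :
    betaMeasure ((s : ℝ) + 1) ((f : ℝ) + 1) (Set.Ici x) ≤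
      ENNReal.ofReal (Real.exp
        (l * s - l * (s + f + 1) * x + l ^ 2 * (s + f + 1) / 8)) := by
  rcases le_or_gt x 1 with hx1 | hx1
  · rw [betaMeasure_Ici_eq hx0 hx1]
    refine ENNReal.ofReal_le_ofReal ?_
    have := sum_bernsteinPolynomial_eval_le hx0 hx1 hl (n := s + f + 1) (s := s) (by omega)
    push_cast at this
    exact this
  · rw [betaMeasure, withDensity_apply _ measurableSet_Ici, setLIntegral_congr_fun
      measurableSet_Ici (g := 0) fun y hy => betaPDF_eq_zero_of_one_le (hx1.le.trans hy)]
    simp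

lemma betaPDF_one_sub (a b y : ℝ) : betaPDF a b (1 - y) = betaPDF b a y := by
  have : beta a b = beta b a := by simp only [beta, mul_comm, add_comm]
  rw [betaPDF_eq, betaPDF_eq, this]
  have h : (0 < 1 - y ∧ 1 - y < 1) ↔ (0 < y ∧ y < 1) := by
    constructor <;> rintro ⟨h1, h2⟩ <;> constructor <;> linarith
  simp only [h, sub_sub_cancel, mul_right_comm]

/-- The reflection `y ↦ 1 - y` exchanges successes and failures, reducing lower tails to upper ones.
-/
lemma betaMeasure_Iic (a b x : ℝ) :
    betaMeasure a b (Set.Iic x) = betaMeasure b a (Set.Ici (1 - x)) := by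
  rw [betaMeasure, betaMeasure, withDensity_apply _ measurableSet_Iic,
    withDensity_apply _ measurableSet_Ici, ← lintegral_indicator measurableSet_Iic,
    ← lintegral_indicator measurableSet_Ici, ← lintegral_sub_left_eq_self _ (1 : ℝ)]
  refine lintegral_congr fun y => ?_
  by_cases h : 1 - y ≤ x
  · rw [Set.indicator_of_mem (show 1 - y ∈ Set.Iic x from h),
      Set.indicator_of_mem (show y ∈ Set.Ici (1 - x) from by simp only [Set.mem_Ici]; linarith),
      betaPDF_one_sub]
  · rw [Set.indicator_of_notMem (show 1 - y ∉ Set.Iic x from h), Set.indicator_of_notMem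
      (show y ∉ Set.Ici (1 - x) from fun h' => h (by simp only [Set.mem_Ici] at h'; linarith))]

/-- If `s` of `s + f` Bernoulli trials with success probability `q` were successful, then the
posterior probability of exceeding `q` by `d` is exponentially small in `s + f`, up to a factor
that is an exponential supermartingale in `(s, f)`. -/
lemma betaMeasure_Ici_add_le {s f : ℕ} {q d : ℝ} (hq : 0 ≤ q) (hd : 0 ≤ d) :
    betaMeasure ((s : ℝ) + 1) ((f : ℝ) + 1) (Set.Ici (q + d)) ≤
      ENNReal.ofReal (Real.exp (-d ^ 2 * (s + f)) *
        Real.exp ((2 * d * (1 - q) - d ^ 2 / 2) * s + (-(2 * d * q) - d ^ 2 / 2) * f)) := by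
  -- The tail and the normalisation of the supermartingale each cost `l²/8` per trial, so the rate
  -- is `-l d + l²/4`, minimal at `l = 2d` with value `-d²`. The extra trial in `s + f + 1` only
  -- helps.
  refine (betaMeasure_Ici_le (l := 2 * d) (by positivity) (by positivity)).trans
    (ENNReal.ofReal_le_ofReal ?_)
  rw [← Real.exp_add, Real.exp_le_exp]
  nlinarith [mul_nonneg hq hd, sq_nonneg d]

lemma betaMeasure_Iic_sub_le {s f : ℕ} {q d : ℝ} (hq : q ≤ 1) (hd : 0 ≤ d) :
    betaMeasure ((s : ℝ) + 1) ((f : ℝ) + 1) (Set.Iic (q - d)) ≤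
      ENNReal.ofReal (Real.exp (-d ^ 2 * (s + f)) *
        Real.exp ((-(2 * d * (1 - q)) - d ^ 2 / 2) * s + (2 * d * q - d ^ 2 / 2) * f)) := by
  rw [betaMeasure_Iic, show 1 - (q - d) = 1 - q + d by ring]
  refine (betaMeasure_Ici_add_le (sub_nonneg.2 hq) hd).trans_eq ?_
  ring_nf

/-! ### Exponential moments of the counters -/

lemma counters_frestrictLe {m : ℕ} {A : Type*} (n : ℕ) (ω : ℕ → Epoch m A) :
    counters n (Preorder.frestrictLe n ω) = ∑ j ∈ Finset.range (n + 1), increment (ω j) := by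
  rw [Nat.range_succ_eq_Iic]
  exact Finset.sum_coe_sort (Finset.Iic n) fun j => increment (ω j)

section Trajectory

variable {m : ℕ} {A : Type*} [MeasurableSpace A] (D : Measure (Fin m → ℝ))
  [IsProbabilityMeasure D] (trig : Kernel (A × (Fin m → ℝ)) (Set (Fin m)))
  [IsMarkovKernel trig] (oracle : Kernel (Fin m → ℝ) A) [IsMarkovKernel oracle]

instance : IsProbabilityMeasure (ctsLaw D trig oracle) := by
  unfold ctsLaw; infer_instance

lemma map_ctsLaw (n : ℕ) :
    (ctsLaw D trig oracle).map (fun ω => (Preorder.frestrictLe n ω, ω (n + 1))) =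
      ((ctsLaw D trig oracle).map (Preorder.frestrictLe n)) ⊗ₘ
        (epochKernel D trig oracle).comap (counters n) (measurable_counters n) :=
  (Kernel.map_frestrictLe_trajMeasure_compProd_eq_map_trajMeasure).symm

lemma map_eval_zero_ctsLaw :
    (ctsLaw D trig oracle).map (fun ω => ω 0) = epochKernel D trig oracle 0 := by
  have hu : (fun ω : ℕ → Epoch m A => ω 0) =
      MeasurableEquiv.piUnique (fun _ : Finset.Iic 0 => Epoch m A) ∘ Preorder.frestrictLe 0 := rfl
  rw [hu, ← Measure.map_map (MeasurableEquiv.measurable _) (by fun_prop), ctsLaw,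
    Kernel.trajMeasure, Measure.map_comp _ _ (by fun_prop), Kernel.traj_map_frestrictLe,
    Kernel.partialTraj_self, Measure.id_comp,
    Measure.map_map (MeasurableEquiv.measurable _) (MeasurableEquiv.measurable _)]
  exact (congrArg (Measure.map · _) (MeasurableEquiv.self_comp_symm _)).trans Measure.map_id

/-- Markov property: the next epoch depends on the past only through the counters. -/
lemma lintegral_ctsLaw_succ (n : ℕ) {G : Counters m × Epoch m A → ENNReal} (hG : Measurable G) :
    ∫⁻ ω, G (counters n (Preorder.frestrictLe n ω), ω (n + 1)) ∂ctsLaw D trig oracle =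
      ∫⁻ ω, ∫⁻ e, G (counters n (Preorder.frestrictLe n ω), e)
        ∂epochKernel D trig oracle (counters n (Preorder.frestrictLe n ω))
        ∂ctsLaw D trig oracle := by
  have hc := measurable_counters (m := m) (A := A) n
  have h := lintegral_map (μ := ctsLaw D trig oracle)
    (f := fun z : ((j : Finset.Iic n) → Epoch m A) × Epoch m A => G (counters n z.1, z.2))
    (g := fun ω => (Preorder.frestrictLe (π := fun _ => Epoch m A) n ω, ω (n + 1)))
    (by fun_prop) (by fun_prop)
  rw [← h, map_ctsLaw, Measure.lintegral_compProd (by fun_prop), lintegral_map _ (by fun_prop)]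
  · rfl
  · exact Measurable.lintegral_kernel_prod_right'
      (κ := (epochKernel D trig oracle).comap (counters n) (measurable_counters n))
      (f := fun z => G (counters n z.1, z.2)) (by fun_prop)

/-- A bound uniform in `ν` and `S` survives averaging over both, so nothing about the oracle's
quality matters. -/
lemma lintegral_epochKernel_le (c : Counters m) {G : Epoch m A → ENNReal} (hG : Measurable G)
    {K : ENNReal} (h : ∀ ν S, ∫⁻ z, G (ν, S, z) ∂envKernel D trig S ≤ K) :
    ∫⁻ e, G e ∂epochKernel D trig oracle c ≤ K := by
  rw [epochKernel, Kernel.lintegral_compProd _ _ _ hG]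
  calc _ ≤ ∫⁻ _, K ∂sampleKernel m c := lintegral_mono fun ν => by
        rw [Kernel.prodMkLeft_apply, Kernel.lintegral_compProd _ _ _ (by fun_prop)]
        calc _ ≤ ∫⁻ _, K ∂oracle ν := lintegral_mono fun S => h ν S
          _ = K := by simp
    _ = K := by simp

/-- A one-step multiplicative drift bound iterates; coordinates `0, …, n` contribute `n + 1`
factors. -/
lemma lintegral_counters_le {F : Counters m → ENNReal} {K : ENNReal}
    (h : ∀ c ν S, ∫⁻ z, F (c + increment (ν, S, z)) ∂envKernel D trig S ≤ K * F c) (n : ℕ) :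
    ∫⁻ ω, F (counters n (Preorder.frestrictLe n ω)) ∂ctsLaw D trig oracle ≤
      K ^ (n + 1) * F 0 := by
  have hi := measurable_increment (m := m) (A := A)
  have hF : Measurable F := measurable_of_countable F
  induction n with
  | zero =>
    simp only [counters_frestrictLe, zero_add, Finset.sum_range_one]
    rw [← lintegral_map (μ := ctsLaw D trig oracle) (f := fun e => F (increment e))
      (g := fun ω => ω 0) (by fun_prop) (by fun_prop), map_eval_zero_ctsLaw, pow_one]
    exact lintegral_epochKernel_le D trig oracle 0 (by fun_prop) fun ν S => by
      simpa using h 0 ν S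
  | succ n ih =>
    have hsucc (ω : ℕ → Epoch m A) : counters (n + 1) (Preorder.frestrictLe (n + 1) ω) =
        counters n (Preorder.frestrictLe n ω) + increment (ω (n + 1)) := by
      rw [counters_frestrictLe, counters_frestrictLe, Finset.sum_range_succ]
    simp only [hsucc]
    rw [lintegral_ctsLaw_succ D trig oracle n (G := fun z => F (z.1 + increment z.2))
      (by fun_prop)]
    calc _ ≤ ∫⁻ ω, K * F (counters n (Preorder.frestrictLe n ω)) ∂ctsLaw D trig oracle :=
          lintegral_mono fun ω => lintegral_epochKernel_le D trig oracle _ (by fun_prop)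
            fun ν S => h _ ν S
      _ = K * ∫⁻ ω, F (counters n (Preorder.frestrictLe n ω)) ∂ctsLaw D trig oracle :=
          lintegral_const_mul _ (hF.comp ((measurable_counters n).comp (by fun_prop)))
      _ ≤ K * (K ^ (n + 1) * F 0) := by gcongr
      _ = _ := by ring

/-- Given the counters, the next sample of arm `i` is the `i`-th marginal of the product of beta
laws. -/
lemma measure_sample_mem (n : ℕ) (i : Fin m) {U : Set (Counters m)} {B : Set ℝ}
    (hB : MeasurableSet B) :
    ctsLaw D trig oracle {ω | counters n (Preorder.frestrictLe n ω) ∈ U ∧ (ω (n + 1)).1 i ∈ B} =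
      ∫⁻ ω, U.indicator (fun c => betaMeasure ((c.1 i : ℝ) + 1) ((c.2 i : ℝ) + 1) B)
        (counters n (Preorder.frestrictLe n ω)) ∂ctsLaw D trig oracle := by
  classical
  have hU : MeasurableSet U := U.to_countable.measurableSet
  have hV : MeasurableSet {z : Counters m × Epoch m A | z.1 ∈ U ∧ z.2.1 i ∈ B} :=
    (measurable_fst hU).inter
      ((show Measurable fun z : Counters m × Epoch m A => z.2.1 i by fun_prop) hB)
  have hc := measurable_counters (m := m) (A := A) n
  have hp : Measurable fun ω : ℕ → Epoch m A =>
      (counters n (Preorder.frestrictLe n ω), ω (n + 1)) := by fun_prop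
  have h := lintegral_ctsLaw_succ D trig oracle n (measurable_one.indicator hV)
  rw [← lintegral_map (measurable_one.indicator hV) hp, lintegral_indicator_one hV,
    Measure.map_apply hp hV] at h
  refine h.trans (lintegral_congr fun ω => ?_)
  generalize counters n (Preorder.frestrictLe n ω) = c
  by_cases hcU : c ∈ U
  · have hprob (j : Fin m) : IsProbabilityMeasure
        (betaMeasure ((c.1 j : ℝ) + 1) ((c.2 j : ℝ) + 1)) :=
      isProbabilityMeasureBeta (by positivity) (by positivity)
    have hfst : (epochKernel D trig oracle c).map Prod.fst = sampleKernel m c := by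
      rw [← Kernel.fst_apply, epochKernel, Kernel.fst_compProd]
    have hs : (sampleKernel m c).map (fun ν => ν i) =
        betaMeasure ((c.1 i : ℝ) + 1) ((c.2 i : ℝ) + 1) :=
      (measurePreserving_eval
        (fun j => betaMeasure ((c.1 j : ℝ) + 1) ((c.2 j : ℝ) + 1)) i).map_eq
    rw [Set.indicator_of_mem hcU, ← hs, ← hfst, Measure.map_map (by fun_prop) (by fun_prop),
      Measure.map_apply (by fun_prop) hB]
    refine Eq.trans ?_
      (lintegral_indicator_one ((show Measurable fun e : Epoch m A => e.1 i by fun_prop) hB))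
    refine lintegral_congr fun e => ?_
    simp [Set.indicator_apply, hcU]
  · simp [hcU]

end Trajectory

/-! ### The environment -/

lemma mean_eq_measureReal {m : ℕ} {D : Measure (Fin m → ℝ)}
    (hbinary : ∀ᵐ x ∂D, ∀ i, x i = 0 ∨ x i = 1) (i : Fin m) :
    mean D i = D.real {x | x i = 1} := by
  have hm : MeasurableSet {x : Fin m → ℝ | x i = 1} :=
    measurableSet_eq_fun (by fun_prop) measurable_const
  rw [mean, ← integral_indicator_one hm]
  refine integral_congr_ae ?_
  filter_upwards [hbinary] with x hx
  rcases hx i with h | h <;> simp [h]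

lemma mean_nonneg {m : ℕ} {D : Measure (Fin m → ℝ)}
    (hbinary : ∀ᵐ x ∂D, ∀ i, x i = 0 ∨ x i = 1) (i : Fin m) : 0 ≤ mean D i := by
  rw [mean_eq_measureReal hbinary]; exact measureReal_nonneg

section Environment

variable {m : ℕ} {A : Type*} [MeasurableSpace A] {D : Measure (Fin m → ℝ)}
  [IsProbabilityMeasure D] {trig : Kernel (A × (Fin m → ℝ)) (Set (Fin m))}
  [IsMarkovKernel trig]

lemma measurableSet_state_eq_one (i : Fin m) :
    MeasurableSet {z : (Fin m → ℝ) × Set (Fin m) | z.1 i = 1} :=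
  measurableSet_eq_fun (by fun_prop) measurable_const

lemma measurableSet_triggered (i : Fin m) :
    MeasurableSet {z : (Fin m → ℝ) × Set (Fin m) | i ∈ z.2} :=
  measurableSet_setOfPred.2 ((measurable_set_mem i).comp measurable_snd)

lemma envKernel_real_state_eq_one (hbinary : ∀ᵐ x ∂D, ∀ i, x i = 0 ∨ x i = 1) (S : A)
    (i : Fin m) : (envKernel D trig S).real {z | z.1 i = 1} = mean D i := by
  have hm : MeasurableSet {x : Fin m → ℝ | x i = 1} :=
    measurableSet_eq_fun (by fun_prop) measurable_const
  have h : (envKernel D trig S).map Prod.fst = D := by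
    rw [← Kernel.fst_apply, envKernel, Kernel.fst_compProd, Kernel.const_apply]
  rw [mean_eq_measureReal hbinary, ← congrArg (fun ρ => ρ.real {x | x i = 1}) h,
    map_measureReal_apply measurable_fst hm]
  rfl

lemma mean_le_one (hbinary : ∀ᵐ x ∂D, ∀ i, x i = 0 ∨ x i = 1) (i : Fin m) : mean D i ≤ 1 := by
  rw [mean_eq_measureReal hbinary]; exact measureReal_le_one

lemma lintegral_exp_increment (hbinary : ∀ᵐ x ∂D, ∀ i, x i = 0 ∨ x i = 1) (S : A) (i : Fin m)
    (htrig : IndepSet {z : (Fin m → ℝ) × Set (Fin m) | z.1 i = 1} {z | i ∈ z.2}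
      (envKernel D trig S)) (a b : ℝ) (ν : Fin m → ℝ) :
    ∫⁻ z, ENNReal.ofReal (Real.exp (a * (increment (ν, S, z)).1 i + b * (increment (ν, S, z)).2 i))
        ∂envKernel D trig S =
      ENNReal.ofReal (1 - atp D trig S i +
        atp D trig S i * (mean D i * Real.exp a + (1 - mean D i) * Real.exp b)) := by
  set κ := envKernel D trig S with hκ
  set V : Set ((Fin m → ℝ) × Set (Fin m)) := {z | z.1 i = 1} with hV
  set T : Set ((Fin m → ℝ) × Set (Fin m)) := {z | i ∈ z.2} with hT
  have mV : MeasurableSet V := measurableSet_state_eq_one i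
  have mT : MeasurableSet T := measurableSet_triggered i
  have hp : κ.real T = atp D trig S i := rfl
  have hq : κ.real V = mean D i := envKernel_real_state_eq_one hbinary S i
  have hp0 : 0 ≤ atp D trig S i := hp ▸ measureReal_nonneg
  have hp1 : 0 ≤ 1 - atp D trig S i := sub_nonneg.2 (hp ▸ measureReal_le_one)
  have hq0 := mean_nonneg hbinary i
  have hq1 := sub_nonneg.2 (mean_le_one hbinary i)
  -- Independence of triggering from the arm's own state makes an observed state Bernoulli with the
  -- true mean.
  have h1 : κ.real (V ∩ T) = mean D i * atp D trig S i := by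
    rw [← hp, ← hq, measureReal_def, (indepSet_iff_measure_inter_eq_mul mV mT κ).1 htrig,
      ENNReal.toReal_mul]
    rfl
  have h2 : κ.real (T \ V) = (1 - mean D i) * atp D trig S i := by
    have := measureReal_inter_add_sdiff (μ := κ) (s := T) mV
    rw [Set.inter_comm, h1, hp] at this
    linarith
  have h3 : κ.real Tᶜ = 1 - atp D trig S i := by rw [probReal_compl_eq_one_sub mT, hp]
  have key (z : (Fin m → ℝ) × Set (Fin m)) :
      ENNReal.ofReal (Real.exp
          (a * (increment (ν, S, z)).1 i + b * (increment (ν, S, z)).2 i)) =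
        (V ∩ T).indicator (fun _ => ENNReal.ofReal (Real.exp a)) z +
        ((T \ V).indicator (fun _ => ENNReal.ofReal (Real.exp b)) z +
          Tᶜ.indicator (fun _ => 1) z) := by
    by_cases hz : i ∈ z.2 <;> by_cases hx : z.1 i = 1 <;>
      simp [increment, hV, hT, hz, hx]
  rw [lintegral_congr key, lintegral_add_left (measurable_const.indicator (mV.inter mT)),
    lintegral_add_left (measurable_const.indicator (mT.diff mV)),
    lintegral_indicator_const (mV.inter mT), lintegral_indicator_const (mT.diff mV),
    lintegral_indicator_const mT.compl, ← ofReal_measureReal, ← ofReal_measureReal,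
    ← ofReal_measureReal, h1, h2, h3, one_mul, ← ENNReal.ofReal_mul (by positivity),
    ← ENNReal.ofReal_mul (by positivity), ← ENNReal.ofReal_add (by positivity) hp1,
    ← ENNReal.ofReal_add (by positivity) (by positivity)]
  congr 1
  ring

/-- If the exponential moment of the counter increments of arm `i` is at most `K` under every
action, then that of the counters grows at most geometrically with ratio `K`. -/
lemma lintegral_exp_counters_le (hbinary : ∀ᵐ x ∂D, ∀ i, x i = 0 ∨ x i = 1) (i : Fin m)
    (htrig : ∀ S : A, IndepSet {z : (Fin m → ℝ) × Set (Fin m) | z.1 i = 1} {z | i ∈ z.2}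
      (envKernel D trig S)) (oracle : Kernel (Fin m → ℝ) A) [IsMarkovKernel oracle] {a b K : ℝ}
    (hK : ∀ S, 1 - atp D trig S i +
      atp D trig S i * (mean D i * Real.exp a + (1 - mean D i) * Real.exp b) ≤ K) (n : ℕ) :
    ∫⁻ ω, ENNReal.ofReal (Real.exp (a * (counters n (Preorder.frestrictLe n ω)).1 i +
        b * (counters n (Preorder.frestrictLe n ω)).2 i)) ∂ctsLaw D trig oracle ≤
      ENNReal.ofReal K ^ (n + 1) := by
  have h := lintegral_counters_le D trig oracle
    (F := fun c => ENNReal.ofReal (Real.exp (a * c.1 i + b * c.2 i)))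
    (K := ENNReal.ofReal K) (fun c ν S => by
      have hsplit (z : (Fin m → ℝ) × Set (Fin m)) :
          ENNReal.ofReal (Real.exp (a * ((c + increment (ν, S, z)).1 i : ℕ) +
            b * ((c + increment (ν, S, z)).2 i : ℕ))) =
          ENNReal.ofReal (Real.exp (a * c.1 i + b * c.2 i)) *
            ENNReal.ofReal (Real.exp
              (a * (increment (ν, S, z)).1 i + b * (increment (ν, S, z)).2 i)) := by
        rw [← ENNReal.ofReal_mul (Real.exp_nonneg _), ← Real.exp_add]
        simp only [Prod.fst_add, Prod.snd_add, Pi.add_apply, Nat.cast_add]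
        ring_nf
      rw [lintegral_congr hsplit, lintegral_const_mul' _ _ ENNReal.ofReal_ne_top,
        lintegral_exp_increment hbinary S i (htrig S), mul_comm]
      gcongr
      exact hK S) n
  simpa using h

/-- Hoeffding's bound on the number of times arm `i` is observed. -/
lemma measure_count_lt_le (hbinary : ∀ᵐ x ∂D, ∀ i, x i = 0 ∨ x i = 1) (i : Fin m)
    (htrig : ∀ S : A, IndepSet {z : (Fin m → ℝ) × Set (Fin m) | z.1 i = 1} {z | i ∈ z.2}
      (envKernel D trig S)) (oracle : Kernel (Fin m → ℝ) A) [IsMarkovKernel oracle]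
    {p r : ℝ} (hp0 : 0 ≤ p) (hp1 : p ≤ 1) (hr : 0 ≤ r)
    (hatp : ∀ S, p ≤ atp D trig S i) (n : ℕ) :
    ctsLaw D trig oracle {ω | ((counters n (Preorder.frestrictLe n ω)).1 i : ℝ) +
        (counters n (Preorder.frestrictLe n ω)).2 i < (p - r) * (n + 1 : ℕ)} ≤
      ENNReal.ofReal (Real.exp (-2 * r ^ 2 * (n + 1 : ℕ))) := by
  -- Equal coefficients count observations; `4r` minimises the Chernoff exponent `-l r + l²/8`. The
  -- moment decreases in the triggering probability, so `p` is the worst case.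
  have hmom := lintegral_exp_counters_le hbinary i htrig oracle (a := -(4 * r)) (b := -(4 * r))
    (K := Real.exp (-(4 * r) * p + (-(4 * r)) ^ 2 / 8)) (fun S => by
      refine le_trans ?_ (bernoulli_mgf_le hp0 hp1 _)
      have : Real.exp (-(4 * r)) ≤ 1 := Real.exp_le_one_iff.2 (by linarith)
      nlinarith [hatp S]) n
  have hc := measurable_counters (m := m) (A := A) n
  have hle (ω : ℕ → Epoch m A) :
      {ω | ((counters n (Preorder.frestrictLe n ω)).1 i : ℝ) +
        (counters n (Preorder.frestrictLe n ω)).2 i < (p - r) * (n + 1 : ℕ)}.indicator 1 ω ≤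
      ENNReal.ofReal (Real.exp (4 * r * (p - r) * (n + 1 : ℕ))) *
        ENNReal.ofReal (Real.exp (-(4 * r) * (counters n (Preorder.frestrictLe n ω)).1 i +
          -(4 * r) * (counters n (Preorder.frestrictLe n ω)).2 i)) := by
    rw [← ENNReal.ofReal_mul (Real.exp_nonneg _), ← Real.exp_add]
    refine Set.indicator_apply_le' (fun hω => ?_) (fun _ => zero_le)
    rw [Pi.one_apply, ENNReal.one_le_ofReal, Real.one_le_exp_iff]
    rw [Set.mem_ofPred_eq] at hω
    nlinarith
  have hm : MeasurableSet {ω : ℕ → Epoch m A |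
      ((counters n (Preorder.frestrictLe n ω)).1 i : ℝ) +
        (counters n (Preorder.frestrictLe n ω)).2 i < (p - r) * (n + 1 : ℕ)} :=
    (show Measurable fun ω : ℕ → Epoch m A => counters n (Preorder.frestrictLe n ω) by fun_prop)
      (Set.to_countable {c : Counters m |
        (c.1 i : ℝ) + c.2 i < (p - r) * (n + 1 : ℕ)}).measurableSet
  rw [← lintegral_indicator_one hm]
  refine (lintegral_mono hle).trans ?_
  rw [lintegral_const_mul' _ _ ENNReal.ofReal_ne_top]
  refine (mul_le_mul_right hmom _).trans_eq ?_
  rw [← ENNReal.ofReal_pow (Real.exp_nonneg _), ← ENNReal.ofReal_mul (Real.exp_nonneg _),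
    ← Real.exp_nat_mul, ← Real.exp_add]
  congr 2
  ring

/-- A sample-tail bound of supermartingale form, integrated over the counters. -/
lemma measure_sample_mem_le (hbinary : ∀ᵐ x ∂D, ∀ i, x i = 0 ∨ x i = 1) (i : Fin m)
    (htrig : ∀ S : A, IndepSet {z : (Fin m → ℝ) × Set (Fin m) | z.1 i = 1} {z | i ∈ z.2}
      (envKernel D trig S)) (oracle : Kernel (Fin m → ℝ) A) [IsMarkovKernel oracle]
    {a b d : ℝ} {B : Set ℝ} (hB : MeasurableSet B)
    (hab : mean D i * Real.exp a + (1 - mean D i) * Real.exp b ≤ 1)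
    (htail : ∀ s f : ℕ, betaMeasure ((s : ℝ) + 1) ((f : ℝ) + 1) B ≤
      ENNReal.ofReal (Real.exp (-d ^ 2 * (s + f)) * Real.exp (a * s + b * f)))
    (k : ℝ) (n : ℕ) :
    ctsLaw D trig oracle {ω | counters n (Preorder.frestrictLe n ω) ∈
        {c : Counters m | k ≤ (c.1 i : ℝ) + c.2 i} ∧ (ω (n + 1)).1 i ∈ B} ≤
      ENNReal.ofReal (Real.exp (-d ^ 2 * k)) := by
  -- By `hab`, an observation does not increase the conditional mean, and an untriggered arm leaves
  -- it unchanged; hence `K = 1` for every action.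
  have hmom := lintegral_exp_counters_le hbinary i htrig oracle (a := a) (b := b) (K := 1)
    (fun S => by
      have : 0 ≤ atp D trig S i := measureReal_nonneg
      nlinarith) n
  rw [measure_sample_mem D trig oracle n i hB]
  calc _ ≤ ∫⁻ ω, ENNReal.ofReal (Real.exp (-d ^ 2 * k)) *
          ENNReal.ofReal (Real.exp (a * (counters n (Preorder.frestrictLe n ω)).1 i +
            b * (counters n (Preorder.frestrictLe n ω)).2 i)) ∂ctsLaw D trig oracle := by
        refine lintegral_mono fun ω => Set.indicator_apply_le' (fun hc => ?_) (fun _ => zero_le)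
        rw [← ENNReal.ofReal_mul (Real.exp_nonneg _)]
        refine (htail _ _).trans (ENNReal.ofReal_le_ofReal ?_)
        gcongr ?_ * _
        rw [Real.exp_le_exp]
        nlinarith [sq_nonneg d, Set.mem_ofPred_eq ▸ hc]
    _ ≤ ENNReal.ofReal (Real.exp (-d ^ 2 * k)) * 1 := by
        rw [lintegral_const_mul' _ _ ENNReal.ofReal_ne_top]
        gcongr
        simpa using hmom
    _ = _ := mul_one _

end Environment

/-! ### Deviation of the sample of one arm -/

section Deviation

variable {m : ℕ} {A : Type*} [MeasurableSpace A] {D : Measure (Fin m → ℝ)}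
  [IsProbabilityMeasure D] {trig : Kernel (A × (Fin m → ℝ)) (Set (Fin m))}
  [IsMarkovKernel trig]

/-- The deviation bound for the sample of a single arm. -/
lemma measureReal_abs_sample_sub_mean_le (hbinary : ∀ᵐ x ∂D, ∀ i, x i = 0 ∨ x i = 1) (i : Fin m)
    (htrig : ∀ S : A, IndepSet {z : (Fin m → ℝ) × Set (Fin m) | z.1 i = 1} {z | i ∈ z.2}
      (envKernel D trig S)) (oracle : Kernel (Fin m → ℝ) A) [IsMarkovKernel oracle]
    {p r δ : ℝ} (hp0 : 0 ≤ p) (hp1 : p ≤ 1) (hr : 0 ≤ r) (hδ : 0 ≤ δ)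
    (hatp : ∀ S, p ≤ atp D trig S i) (n : ℕ) :
    (ctsLaw D trig oracle).real {ω | δ ≤ |(ω (n + 1)).1 i - mean D i|} ≤
      Real.exp (-2 * r ^ 2 * (n + 1 : ℕ)) +
        2 * Real.exp (-δ ^ 2 * ((p - r) * (n + 1 : ℕ))) := by
  set q := mean D i with hq
  have hq0 : 0 ≤ q := mean_nonneg hbinary i
  have hq1 : q ≤ 1 := mean_le_one hbinary i
  have hfew := measure_count_lt_le hbinary i htrig oracle hp0 hp1 hr hatp n
  have hup := measure_sample_mem_le hbinary i htrig oracle (d := δ)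
    (a := 2 * δ * (1 - q) - δ ^ 2 / 2) (b := -(2 * δ * q) - δ ^ 2 / 2)
    (B := Set.Ici (q + δ)) measurableSet_Ici (by
      -- Hoeffding's lemma costs `(2δ)²/8 = δ²/2`, exactly the correction built into `a` and `b`.
      have h := bernoulli_mgf_le hq0 hq1 (2 * δ)
      have e1 : Real.exp (2 * δ * (1 - q) - δ ^ 2 / 2) =
          Real.exp (2 * δ) * Real.exp (-(2 * δ * q) - δ ^ 2 / 2) := by
        rw [← Real.exp_add]; ring_nf
      calc _ = (1 - q + q * Real.exp (2 * δ)) * Real.exp (-(2 * δ * q) - δ ^ 2 / 2) := by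
            rw [e1]; ring
        _ ≤ Real.exp (2 * δ * q + (2 * δ) ^ 2 / 8) * Real.exp (-(2 * δ * q) - δ ^ 2 / 2) := by
            gcongr
        _ = 1 := by rw [← Real.exp_add, Real.exp_eq_one_iff]; ring)
    (fun s f => betaMeasure_Ici_add_le hq0 hδ) ((p - r) * (n + 1 : ℕ)) n
  have hlow := measure_sample_mem_le hbinary i htrig oracle (d := δ)
    (a := -(2 * δ * (1 - q)) - δ ^ 2 / 2) (b := 2 * δ * q - δ ^ 2 / 2)
    (B := Set.Iic (q - δ)) measurableSet_Iic (by
      have h := bernoulli_mgf_le hq0 hq1 (-(2 * δ))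
      have e1 : Real.exp (-(2 * δ * (1 - q)) - δ ^ 2 / 2) =
          Real.exp (-(2 * δ)) * Real.exp (2 * δ * q - δ ^ 2 / 2) := by
        rw [← Real.exp_add]; ring_nf
      calc _ = (1 - q + q * Real.exp (-(2 * δ))) * Real.exp (2 * δ * q - δ ^ 2 / 2) := by
            rw [e1]; ring
        _ ≤ Real.exp (-(2 * δ) * q + (-(2 * δ)) ^ 2 / 8) *
              Real.exp (2 * δ * q - δ ^ 2 / 2) := by
            gcongr
        _ = 1 := by rw [← Real.exp_add, Real.exp_eq_one_iff]; ring)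
    (fun s f => betaMeasure_Iic_sub_le hq1 hδ) ((p - r) * (n + 1 : ℕ)) n
  refine ENNReal.toReal_le_of_le_ofReal (by positivity) ?_
  rw [ENNReal.ofReal_add (by positivity) (by positivity), two_mul,
    ENNReal.ofReal_add (by positivity) (by positivity)]
  refine le_trans (measure_mono fun ω hω => ?_) ((measure_union_le _ _).trans
    (add_le_add hfew ((measure_union_le _ _).trans (add_le_add hup hlow))))
  by_cases hk : ((counters n (Preorder.frestrictLe n ω)).1 i : ℝ) +
      (counters n (Preorder.frestrictLe n ω)).2 i < (p - r) * (n + 1 : ℕ)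
  · exact Or.inl hk
  · rw [Set.mem_ofPred_eq, le_abs] at hω
    rcases hω with h | h
    · exact Or.inr (Or.inl ⟨not_lt.1 hk, by rw [Set.mem_Ici]; linarith⟩)
    · exact Or.inr (Or.inr ⟨not_lt.1 hk, by rw [Set.mem_Iic]; linarith⟩)

end Deviation

/-- Origin of `t'`: `log t = 2 log √t ≤ 2√t/e` always, and `2√t/e ≤ t/c` means `√t ≥ 2c/e`. -/
lemma log_le_div_of_sq_le {c t : ℝ} (hc : 0 < c) (ht0 : 0 < t)
    (ht : 4 * c ^ 2 / Real.exp 1 ^ 2 ≤ t) : Real.log t ≤ t / c := by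
  have he := Real.exp_pos 1
  have h1 : 2 * c / Real.exp 1 ≤ √t := by
    refine Real.le_sqrt_of_sq_le (le_of_eq_of_le ?_ ht)
    ring
  have hs : 0 < √t := Real.sqrt_pos.2 ht0
  have hst : √t * √t = t := Real.mul_self_sqrt ht0.le
  have h2 := Real.log_le_sub_one_of_pos (div_pos hs he)
  rw [Real.log_div hs.ne' he.ne', Real.log_exp, Real.log_sqrt ht0.le] at h2
  have h3 : 2 * c * √t ≤ Real.exp 1 * t := by
    rw [div_le_iff₀ he] at h1
    nlinarith
  have h4 : 2 * (√t / Real.exp 1) ≤ t / c := by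
    rw [← mul_div_assoc, div_le_div_iff₀ he hc]
    linarith
  linarith

end CMAB

/-! ### Union bound over the arms and final constants -/

theorem theorem5 {m : ℕ} {A : Type*} [Finite A] [MeasurableSpace A] [MeasurableSingletonClass A]
    (D : Measure (Fin m → ℝ)) [IsProbabilityMeasure D]
    (hbinary : ∀ᵐ x ∂D, ∀ i, x i = 0 ∨ x i = 1)
    (trig : Kernel (A × (Fin m → ℝ)) (Set (Fin m))) [IsMarkovKernel trig]
    (htrig : ∀ (S : A) (i : Fin m),
      IndepSet {z : (Fin m → ℝ) × Set (Fin m) | z.1 i = 1} {z | i ∈ z.2}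
        (CMAB.envKernel D trig S))
    (oracle : Kernel (Fin m → ℝ) A) [IsMarkovKernel oracle]
    (pstar : ℝ) (hpstar : 0 < pstar) (hatp : ∀ (S : A) (i : Fin m), pstar ≤ CMAB.atp D trig S i)
    (δ η c : ℝ) (hδ : 0 < δ) (hη : η ∈ Set.Ioo (0 : ℝ) 1) (hc : c = 1 / (pstar * (1 - η)) ^ 2)
    (t : ℕ) (ht : 4 * c ^ 2 / Real.exp 1 ^ 2 ≤ (t : ℝ)) :
    (CMAB.ctsLaw D trig oracle).real {ω | δ ≤ CMAB.sampleDeviation D (t + 1) ω} ≤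
      (3 + Real.exp (2 * δ)) * (m : ℝ) *
        (1 / ((t : ℝ) ^ 2 * (1 - Real.exp (-δ ^ 2 / 2))) +
          Real.exp (-δ ^ 2 * η * pstar * (t : ℝ) / 2)) := by

  rcases Nat.eq_zero_or_pos m with rfl | hm
  -- With no arms the supremum is the default value `0 < δ`.
  · have hempty : {ω : ℕ → CMAB.Epoch 0 A | δ ≤ CMAB.sampleDeviation D (t + 1) ω} = ∅ := by
      ext ω
      simp [CMAB.sampleDeviation, hδ]
    simp [hempty]
  have : Nonempty (Fin m) := ⟨⟨0, hm⟩⟩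
  -- The oracle's output law is a probability measure, so an action exists; a triggering probability
  -- then forces `pstar ≤ 1`.
  have : Nonempty A := (oracle 0).nonempty_of_neZero
  have hp1 : pstar ≤ 1 :=
    (hatp (Classical.arbitrary A) (Classical.arbitrary (Fin m))).trans measureReal_le_one
  obtain ⟨hη0, hη1⟩ := hη
  have hr : 0 < pstar * (1 - η) := mul_pos hpstar (sub_pos.2 hη1)
  have hc0 : 0 < c := by rw [hc]; positivity
  have ht0 : (0 : ℝ) < t := lt_of_lt_of_le (by positivity) ht
  -- Coordinates `0, …, n` are the first `t` epochs; coordinate `n + 1` carries the sample of epoch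
  -- `t + 1`.
  obtain ⟨n, rfl⟩ : ∃ n, t = n + 1 := Nat.exists_eq_succ_of_ne_zero (by exact_mod_cast ht0.ne')
  set T : ℝ := ((n + 1 : ℕ) : ℝ) with hT
  have hlog := CMAB.log_le_div_of_sq_le hc0 ht0 ht
  have hfew : Real.exp (-2 * (pstar * (1 - η)) ^ 2 * T) ≤ 1 / T ^ 2 := by
    rw [hc, div_div_eq_mul_div, div_one] at hlog
    rw [one_div, ← Real.exp_log (pow_pos ht0 2), ← Real.exp_neg, Real.exp_le_exp, Real.log_pow]
    push_cast
    linarith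
  have hdenom : 0 < 1 - Real.exp (-δ ^ 2 / 2) := by
    rw [sub_pos, Real.exp_lt_one_iff]
    have := pow_pos hδ 2
    linarith
  -- Pure slack: the factor `1 - exp (-δ²/2)` is at most `1`.
  have hfew' : 1 / T ^ 2 ≤ 1 / (T ^ 2 * (1 - Real.exp (-δ ^ 2 / 2))) := by
    refine one_div_le_one_div_of_le (by positivity) (mul_le_of_le_one_right (by positivity) ?_)
    linarith [Real.exp_pos (-δ ^ 2 / 2)]
  have htail : Real.exp (-δ ^ 2 * ((pstar - pstar * (1 - η)) * T)) ≤
      Real.exp (-δ ^ 2 * η * pstar * T / 2) := by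
    rw [Real.exp_le_exp]
    have : 0 ≤ δ ^ 2 * η * pstar * T := by positivity
    linarith
  set a := 1 / (T ^ 2 * (1 - Real.exp (-δ ^ 2 / 2)))
  set b := Real.exp (-δ ^ 2 * η * pstar * T / 2)
  have ha : 0 ≤ a := by positivity
  have hb : 0 ≤ b := by positivity
  calc (CMAB.ctsLaw D trig oracle).real {ω | δ ≤ CMAB.sampleDeviation D (n + 1 + 1) ω}
      ≤ (CMAB.ctsLaw D trig oracle).real
          (⋃ i : Fin m, {ω | δ ≤ |(ω (n + 1)).1 i - CMAB.mean D i|}) := by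
        refine measureReal_mono fun ω hω => ?_
        obtain ⟨i, hi⟩ := exists_eq_ciSup_of_finite
          (f := fun i : Fin m => |(ω (n + 1)).1 i - CMAB.mean D i|)
        exact Set.mem_iUnion.2 ⟨i, le_of_le_of_eq hω hi.symm⟩
    _ ≤ ∑ i : Fin m, (CMAB.ctsLaw D trig oracle).real
          {ω | δ ≤ |(ω (n + 1)).1 i - CMAB.mean D i|} := measureReal_iUnion_fintype_le _
    _ ≤ ∑ _i : Fin m, (a + 2 * b) := Finset.sum_le_sum fun i _ =>
        (CMAB.measureReal_abs_sample_sub_mean_le hbinary i (fun S => htrig S i) oracle hpstar.le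
          hp1 hr.le hδ.le (fun S => hatp S i) n).trans (by linarith)
    _ = (m : ℝ) * (a + 2 * b) := by
        rw [Finset.sum_const, Finset.card_univ, Fintype.card_fin, nsmul_eq_mul]
    _ ≤ (m : ℝ) * ((3 + Real.exp (2 * δ)) * (a + b)) := by
        gcongr
        nlinarith [Real.exp_pos (2 * δ)]
    _ = _ := by ring
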